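/- Let $Y$ be a connected topological manifold of dimension $n \ge 1$, possibly with boundary (Hausdorff, second countable, locally homeomorphic to open subsets of the half-space $\mathbb{R}^n_+=\{x\in\mathbb{R}^n : x_1\ge 0\}$). Let $X\subseteq Y$ be a locally flat $d$-dimensional submanifold, possibly with boundary: every $x\in X$ has an open neighbourhood $V$ in $Y$ such that the pair $(V, V\cap X)$ is homeomorphic to $(\mathbb{R}^n,\mathbb{R}^d\times 0)$ or, when $d \ge 1$, to $(\mathbb{R}^n_+,\mathbb{R}^d_+\times 0)$ or $(\mathbb{R}^n,\mathbb{R}^d_+\times 0)$. Neither compactness nor closedness of $X$ is assumed. (1) If $n-d\ge 2$, then the inclusion $Y- X\hookrightarrow Y$ induces a bijection on sets of path components, and, for every base point $x\in Y- X$, a surjection $\pi_1(Y- X,x)\to\pi_1(Y,x)$. (2) If $n-d\ge 3$, then for every base point $x\in Y- X$ the inclusion induces an isomorphism $\pi_1(Y- X,x)\to\pi_1(Y,x)$. -/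

import Mathlib

/-- The standard coordinate subspace `ℝᵈ × 0 ⊆ ℝⁿ`: all coordinates except the first `d` vanish. -/
def flatSubspace (n d : ℕ) : Set (EuclideanSpace ℝ (Fin n)) :=
  {v | ∀ i : Fin n, d ≤ (i : ℕ) → v i = 0}

/-- A subset `X` of an `n`-dimensional topological manifold `Y` (possibly with boundary) is a
locally flat `d`-dimensional submanifold (possibly with boundary) if every point of `X` has an open
neighbourhood `V` in `Y` such that the pair `(V, V ∩ X)` is homeomorphic to one of the standard pairs
* `(ℝⁿ, ℝᵈ × 0)` (interior points of `X`),
* `(ℝⁿ₊, ℝᵈ₊ × 0)`, with `1 ≤ d` (boundary of `X` inside the boundary of `Y`),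
* `(ℝⁿ, ℝᵈ₊ × 0)`, with `1 ≤ d` (boundary of `X` inside the interior of `Y`).
Here `ℝᵏ₊` is the half-space where the first coordinate is nonnegative.
It is not required that `X` be closed in `Y`. -/
def IsLocallyFlat {Y : Type*} [TopologicalSpace Y] (n d : ℕ) [NeZero n] (X : Set Y) : Prop :=
  ∀ x ∈ X, ∃ V : Set Y, IsOpen V ∧ x ∈ V ∧
    ((∃ φ : V ≃ₜ EuclideanSpace ℝ (Fin n),
        ∀ y : V, (y : Y) ∈ X ↔ φ y ∈ flatSubspace n d) ∨
     (1 ≤ d ∧ ∃ φ : V ≃ₜ EuclideanHalfSpace n,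
        ∀ y : V, (y : Y) ∈ X ↔ (φ y).val ∈ flatSubspace n d) ∨
     (1 ≤ d ∧ ∃ φ : V ≃ₜ EuclideanSpace ℝ (Fin n),
        ∀ y : V, (y : Y) ∈ X ↔ φ y ∈ flatSubspace n d ∧ 0 ≤ φ y 0))

/-- The map on sets of path components induced by a continuous map. -/
def piZeroMap {A B : Type*} [TopologicalSpace A] [TopologicalSpace B] (f : C(A, B)) :
    ZerothHomotopy A → ZerothHomotopy B :=
  ZerothHomotopy.lift (fun a => ZerothHomotopy.mk (f a))
    (fun _ _ p => ZerothHomotopy.sound (p.map f.continuous))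

/-- The inclusion `Y - X ↪ Y` as a continuous map. -/
def complInclusion {Y : Type*} [TopologicalSpace Y] (X : Set Y) : C((Xᶜ : Set Y), Y) :=
  ⟨Subtype.val, continuous_subtype_val⟩

/-! This is general position. Locally, `X` lies in the zero set of a projection to `ℝⁿ⁻ᵈ`, and
translations in that direction change the projection at will. Smooth images of spaces of dimension
below `n - d` have dense complement in `ℝⁿ⁻ᵈ`, so a small translation pushes such a piece of a map
off a given compact part of `X` (`TransverseChart.exists_perturbation`). As `X` need not be closed,
its complement need not be open, and nearby maps may meet `X` again. Instead, `X` is a countable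
union of compact pieces; avoiding each is an open dense condition on maps, and Baire's theorem gives
a map avoiding all. Relative to part of a square, this moves one side (dimension 1, codimension at
least 2) or the whole square (dimension 2, codimension at least 3) off `X`. -/

open Set Filter Topology

/-! ### Perturbation in one transverse chart -/

/-- A partially defined projection of a space to `ℝᵐ`, together with translations in the direction
of `ℝᵐ`: the part of a product structure `V ≃ P × ℝᵐ` of an open set `V` that is needed to push
maps off the zero set of the projection. -/
structure TransverseChart {Y : Type*} [TopologicalSpace Y] (V : Set Y) (m : ℕ) where
  proj : Y → Fin m → ℝ
  translate : Y → (Fin m → ℝ) → Y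
  isOpen : IsOpen V
  continuousOn_proj : ContinuousOn proj V
  continuousOn_translate : ContinuousOn (fun q : Y × (Fin m → ℝ) => translate q.1 q.2) (V ×ˢ univ)
  translate_zero : ∀ y, translate y 0 = y
  translate_mem : ∀ y ∈ V, ∀ w, translate y w ∈ V
  proj_translate : ∀ y ∈ V, ∀ w, proj (translate y w) = proj y + w

theorem TransverseChart.exists_translate_dist_lt {Y : Type*} [MetricSpace Y] {V : Set Y} {m : ℕ}
    (c : TransverseChart V m) {Q : Set Y} (hQ : IsCompact Q) (hQV : Q ⊆ V) {ε : ℝ} (hε : 0 < ε) :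
    ∃ δ > 0, ∀ w, ‖w‖ < δ → ∀ y ∈ Q, dist (c.translate y w) y < ε := by
  have key : ∀ᶠ w in 𝓝 (0 : Fin m → ℝ), ∀ y ∈ Q, dist (c.translate y w) y < ε := by
    refine hQ.eventually_forall_of_forall_eventually fun y hy => ?_
    have h1 : ContinuousAt (fun q : Y × (Fin m → ℝ) => c.translate q.1 q.2) (y, 0) :=
      c.continuousOn_translate.continuousAt
        ((c.isOpen.prod isOpen_univ).mem_nhds ⟨hQV hy, mem_univ _⟩)
    have h2 : ContinuousAt (fun q : (Fin m → ℝ) × Y => dist (c.translate q.2 q.1) q.2) (0, y) :=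
      (ContinuousAt.comp (f := Prod.swap) (x := ((0 : Fin m → ℝ), y)) h1
        continuous_swap.continuousAt).dist continuousAt_snd
    exact h2.eventually_lt continuousAt_const (by simpa [c.translate_zero] using hε)
  obtain ⟨δ, hδ, h⟩ := Metric.eventually_nhds_iff.1 key
  exact ⟨δ, hδ, fun w hw => h (by simpa using hw)⟩

/-- Approximate `q` by a smooth map, then subtract a small constant outside its image on `range ℓ`,
which has dense complement for dimension reasons. -/
theorem exists_contDiff_dist_lt_forall_ne {E E' : Type*} [NormedAddCommGroup E] [NormedSpace ℝ E]
    [FiniteDimensional ℝ E] [NormedAddCommGroup E'] [NormedSpace ℝ E']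
    [FiniteDimensional ℝ E'] {m : ℕ} (hm : Module.finrank ℝ E' < m) {ℓ : E' → E}
    (hℓ : ContDiff ℝ 1 ℓ) {q : E → Fin m → ℝ} (hq : Continuous q) {δ : ℝ} (hδ : 0 < δ) :
    ∃ g : E → Fin m → ℝ, Continuous g ∧ (∀ x, ‖g x - q x‖ < δ) ∧ ∀ s, g (ℓ s) ≠ 0 := by
  obtain ⟨g, hg, hgq, -⟩ := hq.exists_contDiff_approx (ε := fun _ => δ / 2) 1 continuous_const
    (fun _ => half_pos hδ)
  have hdense : Dense (range (g ∘ ℓ))ᶜ :=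
    ContDiff.dense_compl_range_of_finrank_lt_finrank (hg.comp hℓ) (by simpa using hm)
  obtain ⟨c, hc, hcδ⟩ := hdense.exists_dist_lt 0 (half_pos hδ)
  refine ⟨fun x => g x - c, hg.continuous.sub continuous_const, fun x => ?_, fun s hs =>
    hc ⟨s, sub_eq_zero.1 hs⟩⟩
  have h1 := hgq x
  rw [dist_eq_norm] at h1
  rw [dist_zero_left] at hcδ
  calc ‖g x - c - q x‖ = ‖(g x - q x) - c‖ := by congr 1; abel
    _ ≤ ‖g x - q x‖ + ‖c‖ := norm_sub_le _ _
    _ < δ := by linarith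

/-- A map on a compact subset `T` of a finite dimensional space can be perturbed relative to `A`
such that the part `B` of `T` of dimension less than `m` is pushed off a compact subset of the zero
set of a transverse chart of dimension `m`. -/
theorem TransverseChart.exists_perturbation {Y : Type*} [MetricSpace Y] [LocallyCompactSpace Y]
    {V : Set Y} {m : ℕ} (c : TransverseChart V m) {T : Type*} [TopologicalSpace T]
    [CompactSpace T] {E E' : Type} [NormedAddCommGroup E] [NormedSpace ℝ E]
    [FiniteDimensional ℝ E] [NormedAddCommGroup E'] [NormedSpace ℝ E'] [FiniteDimensional ℝ E']
    (hm : Module.finrank ℝ E' < m) {ℓ : E' → E} (hℓ : ContDiff ℝ 1 ℓ) {e : T → E}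
    (he : IsEmbedding e) {A B : Set T} (hA : IsClosed A) (hB : IsClosed B)
    (hBℓ : ∀ t ∈ B, e t ∈ range ℓ) {K : Set Y} (hK : IsCompact K) (hKV : K ⊆ V)
    (hK0 : ∀ y ∈ K, c.proj y = 0) (F : C(T, Y)) (hF : ∀ t ∈ A ∩ B, F t ∉ K) {ε : ℝ} (hε : 0 < ε) :
    ∃ G : C(T, Y), EqOn G F A ∧ (∀ t, dist (G t) (F t) < ε) ∧ ∀ t ∈ B, G t ∉ K := by
  have : T2Space T := he.t2Space
  have hAB : IsCompact (F '' (A ∩ B)) := (hA.inter hB).isCompact.image F.continuous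
  -- On `B ∩ F ⁻¹' K'` the full perturbation is applied; `K'` avoids `F '' (A ∩ B)`, so this set is
  -- disjoint from `A`. Outside `Q` nothing moves.
  obtain ⟨K', hK', hKK', hK'V⟩ := exists_compact_between hK (c.isOpen.inter hAB.isClosed.isOpen_compl)
    (fun y hy => ⟨hKV hy, fun ⟨t, ht, h⟩ => hF t ht (h ▸ hy)⟩)
  obtain ⟨Q, hQ, hK'Q, hQV⟩ := exists_compact_between hK' c.isOpen fun y hy => (hK'V hy).1
  obtain ⟨r, hr, hrK⟩ := hK.exists_thickening_subset_open isOpen_interior hKK'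
  obtain ⟨δ, hδ, hδQ⟩ := c.exists_translate_dist_lt hQ hQV (lt_min hε hr)
  -- the bump function
  obtain ⟨lam, hlam0, hlam1, hlamI⟩ := exists_continuous_zero_one_of_isClosed
    (s := A ∪ F ⁻¹' (interior Q)ᶜ) (t := B ∩ F ⁻¹' K')
    (hA.union (isOpen_interior.isClosed_compl.preimage F.continuous))
    (hB.inter (hK'.isClosed.preimage F.continuous)) (by
      rw [Set.disjoint_left]
      rintro t (ht | ht) ⟨htB, htK⟩
      · exact (hK'V htK).2 ⟨t, ⟨ht, htB⟩, rfl⟩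
      · exact ht (hK'Q htK))
  have hlamQ : ∀ t, F t ∉ Q → lam t = 0 := fun t ht =>
    hlam0 (Or.inr fun h => ht (interior_subset h))
  -- the projection, extended to the ambient space
  have hFQ : IsClosed (F ⁻¹' Q) := hQ.isClosed.preimage F.continuous
  have : CompactSpace (F ⁻¹' Q) := isCompact_iff_compactSpace.1 hFQ.isCompact
  let q₀ : C(F ⁻¹' Q, Fin m → ℝ) := ⟨fun t => c.proj (F t),
    c.continuousOn_proj.comp_continuous (F.continuous.comp continuous_subtype_val)
      fun t => hQV t.2⟩
  have he' : IsClosedEmbedding fun t : F ⁻¹' Q => e t :=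
    ⟨he.comp IsEmbedding.subtypeVal,
      (isCompact_range (he.continuous.comp continuous_subtype_val)).isClosed⟩
  obtain ⟨q, hq⟩ := q₀.exists_extension he'
  have hqF : ∀ t, F t ∈ Q → q (e t) = c.proj (F t) := fun t ht =>
    congrArg (fun f : C(F ⁻¹' Q, Fin m → ℝ) => f ⟨t, ht⟩) hq
  obtain ⟨g, hgc, hgq, hg0⟩ := exists_contDiff_dist_lt_forall_ne hm hℓ q.continuous hδ
  -- Where `lam = 1` and `F t ∈ Q`, translating by `w t` changes the projection from `q (e t)` to `g
  -- (e t)`.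
  let w : T → Fin m → ℝ := fun t => lam t • (g (e t) - q (e t))
  have hw : Continuous w := lam.continuous.smul
    ((hgc.comp he.continuous).sub (q.continuous.comp he.continuous))
  have hwδ : ∀ t, ‖w t‖ < δ := fun t => by
    refine lt_of_le_of_lt ?_ (hgq (e t))
    rw [norm_smul, Real.norm_of_nonneg (hlamI t).1]
    exact mul_le_of_le_one_left (norm_nonneg _) (hlamI t).2
  have hG : Continuous fun t => c.translate (F t) (w t) := by
    rw [continuous_iff_continuousAt]
    intro t
    by_cases ht : F t ∈ V
    · have h1 : ContinuousAt (fun q : Y × (Fin m → ℝ) => c.translate q.1 q.2) (F t, w t) :=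
        c.continuousOn_translate.continuousAt
          ((c.isOpen.prod isOpen_univ).mem_nhds ⟨ht, mem_univ _⟩)
      exact ContinuousAt.comp (f := fun t => (F t, w t)) h1
        (F.continuous.prodMk hw).continuousAt
    · refine F.continuous.continuousAt.congr ?_
      filter_upwards [hFQ.isOpen_compl.mem_nhds fun h => ht (hQV h)] with s hs
      simp [w, hlamQ s hs, c.translate_zero]
  have hdist : ∀ t, dist (c.translate (F t) (w t)) (F t) < min ε r := fun t => by
    by_cases ht : F t ∈ Q
    · exact hδQ _ (hwδ t) _ ht
    · simp [w, hlamQ t ht, c.translate_zero, hε, hr]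
  refine ⟨⟨_, hG⟩, fun t ht => ?_, fun t => (hdist t).trans_le (min_le_left _ _), fun t ht hGK => ?_⟩
  · simp [w, hlam0 (Or.inl ht), c.translate_zero]
  · have hGK : c.translate (F t) (w t) ∈ K := hGK
    -- Points move by less than `r`, so only points starting in `K'` can land in `K`.
    have htK' : F t ∈ K' := interior_subset <| hrK <| Metric.mem_thickening_iff.2
      ⟨_, hGK, by rw [dist_comm]; exact (hdist t).trans_le (min_le_right _ _)⟩
    obtain ⟨s, hs⟩ := hBℓ t ht
    apply hg0 s
    have h0 := hK0 _ hGK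
    rw [c.proj_translate _ (hK'V htK').1] at h0
    have h1 : lam t = 1 := hlam1 ⟨ht, htK'⟩
    rw [← hqF t (interior_subset (hK'Q htK'))] at h0
    simpa [w, h1, hs] using h0

/-! ### Avoiding countably many compact sets by Baire category -/

/-- General position: a map on a compact subset `T` of a finite dimensional space can be changed
relative to `A` such that the part `B` of `T` avoids the set `X`, if `X` is a countable union of
compact sets that lie in the zero sets of transverse charts of a dimension larger than that of
`B`. -/
theorem exists_eqOn_forall_notMem {Y : Type*} [TopologicalSpace Y] [T2Space Y]
    [SecondCountableTopology Y] [LocallyCompactSpace Y] {m : ℕ} {X : Set Y} {ι : Type*}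
    [Countable ι] {V K : ι → Set Y} (c : ∀ i, TransverseChart (V i) m)
    (hK : ∀ i, IsCompact (K i)) (hKV : ∀ i, K i ⊆ V i) (hK0 : ∀ i, ∀ y ∈ K i, (c i).proj y = 0)
    (hX : X = ⋃ i, K i) {T : Type*} [TopologicalSpace T]
    [CompactSpace T] {E E' : Type} [NormedAddCommGroup E] [NormedSpace ℝ E]
    [FiniteDimensional ℝ E] [NormedAddCommGroup E'] [NormedSpace ℝ E'] [FiniteDimensional ℝ E']
    (hm : Module.finrank ℝ E' < m) {ℓ : E' → E} (hℓ : ContDiff ℝ 1 ℓ) {e : T → E}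
    (he : IsEmbedding e) {A B : Set T} (hA : IsClosed A) (hB : IsClosed B)
    (hBℓ : ∀ t ∈ B, e t ∈ range ℓ) (F : C(T, Y)) (hF : ∀ t ∈ A ∩ B, F t ∉ X) :
    ∃ G : C(T, Y), EqOn G F A ∧ ∀ t ∈ B, G t ∉ X := by
  let _ : MetricSpace Y := TopologicalSpace.metrizableSpaceMetric Y
  -- The metric on `Y` need not be complete; a compact target `Z` makes the space of maps complete.
  -- Requiring values in `interior Z` leaves room for perturbations.
  obtain ⟨Z, hZ, hFZ⟩ := exists_compact_superset (isCompact_range F.continuous)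
  have : CompactSpace Z := isCompact_iff_compactSpace.1 hZ
  let M : Set C(T, Z) := {g | ∀ t ∈ A, (g t : Y) = F t}
  have hM : IsClosed M := by
    simp only [M, ofPred_forall]
    refine isClosed_iInter fun t => isClosed_iInter fun _ => isClosed_eq ?_ continuous_const
    exact continuous_subtype_val.comp (continuous_eval_const t)
  have : CompleteSpace M := hM.isComplete.completeSpace_coe
  have hopen : ∀ {C : Set T} {U : Set Y}, IsClosed C → IsOpen U →
      IsOpen {g : M | ∀ t ∈ C, (g.1 t : Y) ∈ U} := fun {C U} hC hU =>
    (ContinuousMap.isOpen_setOfPred_mapsTo hC.isCompact (hU.preimage continuous_subtype_val)).preimage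
      continuous_subtype_val
  let O : Set M := {g | ∀ t ∈ (univ : Set T), (g.1 t : Y) ∈ interior Z}
  have hO : IsOpen O := hopen isClosed_univ isOpen_interior
  have : BaireSpace O := hO.baireSpace
  let D : ι → Set O := fun i => {g | ∀ t ∈ B, (g.1.1 t : Y) ∈ (K i)ᶜ}
  have hD : ∀ i, IsOpen (D i) := fun i =>
    (hopen hB (hK i).isClosed.isOpen_compl).preimage continuous_subtype_val
  have hdense : ∀ i, Dense (D i) := by
    intro i
    rw [Metric.dense_iff]
    intro g ε hε
    let g' : C(T, Y) := ⟨fun t => g.1.1 t, continuous_subtype_val.comp g.1.1.continuous⟩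
    obtain ⟨r, hr, hrZ⟩ := (isCompact_range g'.continuous).exists_thickening_subset_open
      isOpen_interior (range_subset_iff.2 fun t => g.2 t (mem_univ t))
    obtain ⟨G, hGA, hGd, hGB⟩ := (c i).exists_perturbation hm hℓ he hA hB hBℓ (hK i) (hKV i) (hK0 i)
      g' (fun t ht h => hF t ht (hX ▸ mem_iUnion.2 ⟨i, by
        have := g.1.2 t ht.1
        rw [← this]; exact h⟩)) (lt_min (half_pos hε) hr)
    have hGZ : ∀ t, G t ∈ interior Z := fun t => hrZ <| Metric.mem_thickening_iff.2
      ⟨g' t, mem_range_self t, (hGd t).trans_le (min_le_right _ _)⟩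
    refine ⟨⟨⟨⟨fun t => ⟨G t, interior_subset (hGZ t)⟩, G.continuous.subtype_mk _⟩,
      fun t ht => (hGA ht).trans (g.1.2 t ht)⟩, fun t _ => hGZ t⟩, ?_, fun t ht => hGB t ht⟩
    rw [Metric.mem_ball]
    refine lt_of_le_of_lt ?_ (half_lt_self hε)
    exact (ContinuousMap.dist_le (half_pos hε).le).2
      fun t => ((hGd t).trans_le (min_le_left _ _)).le
  let g₀ : O := ⟨⟨⟨fun t => ⟨F t, interior_subset (hFZ (mem_range_self t))⟩,
    F.continuous.subtype_mk _⟩, fun t _ => rfl⟩, fun t _ => hFZ (mem_range_self t)⟩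
  have : Nonempty O := ⟨g₀⟩
  obtain ⟨g, hg⟩ := (dense_iInter_of_isOpen hD hdense).nonempty
  refine ⟨⟨fun t => g.1.1 t, continuous_subtype_val.comp g.1.1.continuous⟩,
    fun t ht => g.1.2 t ht, fun t ht h => ?_⟩
  obtain ⟨i, hi⟩ := mem_iUnion.1 (hX ▸ h)
  exact mem_iInter.1 hg i t ht hi

/-! ### Transverse charts of locally flat subsets -/

/-- The last `n - d` coordinates of a vector in `ℝⁿ`. -/
def normalProjection (n d : ℕ) (v : EuclideanSpace ℝ (Fin n)) : Fin (n - d) → ℝ :=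
  fun j => v ⟨d + j, by omega⟩

/-- The inclusion of `0 × ℝⁿ⁻ᵈ` into `ℝⁿ`. -/
def normalInclusion (n d : ℕ) (w : Fin (n - d) → ℝ) : EuclideanSpace ℝ (Fin n) :=
  WithLp.toLp 2 fun i => if h : d ≤ (i : ℕ) then w ⟨i - d, by omega⟩ else 0

theorem continuous_normalProjection (n d : ℕ) : Continuous (normalProjection n d) := by
  unfold normalProjection
  fun_prop

theorem continuous_normalInclusion (n d : ℕ) : Continuous (normalInclusion n d) := by
  unfold normalInclusion
  refine (PiLp.continuous_toLp 2 _).comp (continuous_pi fun i => ?_)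
  split_ifs <;> fun_prop

theorem normalInclusion_zero (n d : ℕ) : normalInclusion n d 0 = 0 := by
  ext i
  simp [normalInclusion]

theorem normalProjection_add_normalInclusion (n d : ℕ) (v : EuclideanSpace ℝ (Fin n))
    (w : Fin (n - d) → ℝ) :
    normalProjection n d (v + normalInclusion n d w) = normalProjection n d v + w := by
  ext j
  simp [normalProjection, normalInclusion]

theorem normalInclusion_apply_of_lt {n d : ℕ} (w : Fin (n - d) → ℝ) {i : Fin n}
    (hi : (i : ℕ) < d) : normalInclusion n d w i = 0 := by
  simp [normalInclusion, not_le.2 hi]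

theorem normalProjection_eq_zero {n d : ℕ} {v : EuclideanSpace ℝ (Fin n)}
    (hv : v ∈ flatSubspace n d) : normalProjection n d v = 0 :=
  funext fun _ => hv _ (Nat.le_add_right _ _)

theorem isClosed_flatSubspace (n d : ℕ) : IsClosed (flatSubspace n d) := by
  simp only [flatSubspace, ofPred_forall]
  exact isClosed_iInter fun i => isClosed_iInter fun _ => isClosed_eq (by fun_prop) continuous_const

open Classical in
/-- The transverse chart induced by a homeomorphism to a model space with translations. -/
noncomputable def TransverseChart.ofHomeomorph {Y : Type*} [TopologicalSpace Y] {V : Set Y}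
    (hV : IsOpen V) {H : Type*} [TopologicalSpace H] (φ : V ≃ₜ H) {m : ℕ} (p : H → Fin m → ℝ)
    (hp : Continuous p) (τ : H → (Fin m → ℝ) → H)
    (hτ : Continuous fun q : H × (Fin m → ℝ) => τ q.1 q.2)
    (hτ0 : ∀ h, τ h 0 = h) (hpτ : ∀ h w, p (τ h w) = p h + w) : TransverseChart V m where
  proj y := if hy : y ∈ V then p (φ ⟨y, hy⟩) else 0
  translate y w := if hy : y ∈ V then φ.symm (τ (φ ⟨y, hy⟩) w) else y
  isOpen := hV
  continuousOn_proj := by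
    rw [continuousOn_iff_continuous_domRestrict]
    refine (hp.comp φ.continuous).congr fun y => ?_
    simp
  continuousOn_translate := by
    rw [continuousOn_iff_continuous_domRestrict]
    have h1 : Continuous fun q : (V ×ˢ (univ : Set (Fin m → ℝ)) : Set _) =>
        (φ.symm (τ (φ ⟨q.1.1, q.2.1⟩) q.1.2) : Y) :=
      continuous_subtype_val.comp <| φ.symm.continuous.comp <| hτ.comp <|
        (φ.continuous.comp ((continuous_fst.comp continuous_subtype_val).subtype_mk _)).prodMk
          (continuous_snd.comp continuous_subtype_val)
    refine h1.congr fun q => ?_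
    simp [q.2.1]
  translate_zero y := by
    split_ifs <;> simp [hτ0]
  translate_mem y hy w := by simp [hy]
  proj_translate y hy w := by simp [hy, hpτ]

theorem TransverseChart.ofHomeomorph_proj {Y : Type*} [TopologicalSpace Y] {V : Set Y}
    (hV : IsOpen V) {H : Type*} [TopologicalSpace H] (φ : V ≃ₜ H) {m : ℕ} (p : H → Fin m → ℝ)
    (hp : Continuous p) (τ : H → (Fin m → ℝ) → H)
    (hτ : Continuous fun q : H × (Fin m → ℝ) => τ q.1 q.2)
    (hτ0 : ∀ h, τ h 0 = h) (hpτ : ∀ h w, p (τ h w) = p h + w) (y : V) :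
    (ofHomeomorph hV φ p hp τ hτ hτ0 hpτ).proj y = p (φ y) := by
  simp [ofHomeomorph]

theorem IsLocallyFlat.exists_transverseChart {Y : Type*} [TopologicalSpace Y] {n d : ℕ} [NeZero n]
    {X : Set Y} (hX : IsLocallyFlat n d X) {x : Y} (hx : x ∈ X) :
    ∃ V : Set Y, x ∈ V ∧ ∃ c : TransverseChart V (n - d), (∀ y : V, (y : Y) ∈ X → c.proj y = 0) ∧
      IsClosed {y : V | (y : Y) ∈ X} := by
  obtain ⟨V, hV, hxV, h⟩ := hX x hx
  have hadd : Continuous fun q : EuclideanSpace ℝ (Fin n) × (Fin (n - d) → ℝ) =>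
      q.1 + normalInclusion n d q.2 :=
    continuous_fst.add ((continuous_normalInclusion n d).comp continuous_snd)
  refine ⟨V, hxV, ?_⟩
  obtain ⟨φ, hφ⟩ | ⟨hd, φ, hφ⟩ | ⟨hd, φ, hφ⟩ := h
  · refine ⟨.ofHomeomorph hV φ (normalProjection n d) (continuous_normalProjection n d)
      (fun v w => v + normalInclusion n d w) hadd (by simp [normalInclusion_zero])
      (normalProjection_add_normalInclusion n d), fun y hy => ?_, ?_⟩
    · rw [TransverseChart.ofHomeomorph_proj]
      exact normalProjection_eq_zero ((hφ y).1 hy)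
    · simp only [hφ]
      exact (isClosed_flatSubspace n d).preimage φ.continuous
  · refine ⟨.ofHomeomorph hV φ (fun v => normalProjection n d v.val)
      ((continuous_normalProjection n d).comp continuous_subtype_val)
      (fun v w => ⟨v.val + normalInclusion n d w, ?_⟩) ?_ (fun v => Subtype.ext ?_)
      (fun v => normalProjection_add_normalInclusion n d v.val), fun y hy => ?_, ?_⟩
    · have := normalInclusion_apply_of_lt w (i := (0 : Fin n)) (by simpa using Nat.pos_of_ne_zero (by omega))
      simpa [this] using v.property
    · exact (hadd.comp ((continuous_subtype_val.comp continuous_fst).prodMk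
        continuous_snd)).subtype_mk _
    · simp [normalInclusion_zero]
    · rw [TransverseChart.ofHomeomorph_proj]
      exact normalProjection_eq_zero ((hφ y).1 hy)
    · simp only [hφ]
      exact (isClosed_flatSubspace n d).preimage (continuous_subtype_val.comp φ.continuous)
  · refine ⟨.ofHomeomorph hV φ (normalProjection n d) (continuous_normalProjection n d)
      (fun v w => v + normalInclusion n d w) hadd (by simp [normalInclusion_zero])
      (normalProjection_add_normalInclusion n d), fun y hy => ?_, ?_⟩
    · rw [TransverseChart.ofHomeomorph_proj]
      exact normalProjection_eq_zero ((hφ y).1 hy).1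
    · simp only [hφ]
      exact ((isClosed_flatSubspace n d).preimage φ.continuous).inter
        (isClosed_le continuous_const
          ((by fun_prop : Continuous fun v : EuclideanSpace ℝ (Fin n) => v 0).comp φ.continuous))

/-- `X` is relatively closed in each chart domain, so it meets a compact neighbourhood inside the
domain in a compact set. -/
theorem IsLocallyFlat.exists_compact_chart {Y : Type*} [TopologicalSpace Y] [T2Space Y]
    [LocallyCompactSpace Y] {n d : ℕ} [NeZero n] {X : Set Y} (hX : IsLocallyFlat n d X)
    (x : X) : ∃ V K : Set Y, ∃ c : TransverseChart V (n - d), IsCompact K ∧ K ⊆ V ∧ K ⊆ X ∧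
      (∀ y ∈ K, c.proj y = 0) ∧ K ∈ 𝓝[X] (x : Y) := by
  obtain ⟨V, hxV, c, hc0, hclosed⟩ := hX.exists_transverseChart x.2
  obtain ⟨Q, hQx, hQV, hQ⟩ := local_compact_nhds (c.isOpen.mem_nhds hxV)
  refine ⟨V, Q ∩ X, c, ?_, fun y hy => hQV hy.1, inter_subset_right,
    fun y hy => hc0 ⟨y, hQV hy.1⟩ hy.2,
    inter_mem (mem_nhdsWithin_of_mem_nhds hQx) self_mem_nhdsWithin⟩
  obtain ⟨C, hC, hCX⟩ := isClosed_induced_iff.1 hclosed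
  have : Q ∩ X = Q ∩ C := by
    ext y
    refine and_congr_right fun hy => ?_
    exact (Set.ext_iff.1 hCX ⟨y, hQV hy⟩).symm
  rw [this]
  exact hQ.inter_right hC

theorem IsLocallyFlat.exists_eqOn_forall_notMem {Y : Type*} [TopologicalSpace Y] [T2Space Y]
    [SecondCountableTopology Y] [LocallyCompactSpace Y] {n d : ℕ} [NeZero n] {X : Set Y}
    (hX : IsLocallyFlat n d X) {T : Type*} [TopologicalSpace T]
    [CompactSpace T] {E E' : Type} [NormedAddCommGroup E] [NormedSpace ℝ E]
    [FiniteDimensional ℝ E] [NormedAddCommGroup E'] [NormedSpace ℝ E'] [FiniteDimensional ℝ E']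
    (hm : Module.finrank ℝ E' < n - d) {ℓ : E' → E} (hℓ : ContDiff ℝ 1 ℓ) {e : T → E}
    (he : IsEmbedding e) {A B : Set T} (hA : IsClosed A) (hB : IsClosed B)
    (hBℓ : ∀ t ∈ B, e t ∈ range ℓ) (F : C(T, Y)) (hF : ∀ t ∈ A ∩ B, F t ∉ X) :
    ∃ G : C(T, Y), EqOn G F A ∧ ∀ t ∈ B, G t ∉ X := by
  choose V K c hK hKV hKX hK0 hKx using hX.exists_compact_chart
  obtain ⟨s, hs, hsX⟩ := TopologicalSpace.countable_cover_nhds (α := X)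
    (f := fun x => (↑) ⁻¹' K x) fun x => preimage_coe_mem_nhds_subtype.2 (hKx x)
  have : Countable s := hs.to_subtype
  refine _root_.exists_eqOn_forall_notMem (ι := s) (fun i => c i) (fun i => hK i) (fun i => hKV i)
    (fun i => hK0 i) ?_ hm hℓ he hA hB hBℓ F hF
  refine Subset.antisymm (fun x hx => ?_) (iUnion_subset fun i => hKX i)
  obtain ⟨i, hi, hxi⟩ := mem_iUnion₂.1 (hsX ▸ mem_univ (⟨x, hx⟩ : X))
  exact mem_iUnion.2 ⟨⟨i, hi⟩, hxi⟩

/-! ### Paths and homotopies in the complement -/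

open unitInterval

theorem isEmbedding_unitSquare : IsEmbedding (Prod.map ((↑) : I → ℝ) ((↑) : I → ℝ)) :=
  IsEmbedding.subtypeVal.prodMap IsEmbedding.subtypeVal

/-- Paths with end points outside a locally flat subset of codimension at least two are homotopic
to paths in the complement. -/
theorem IsLocallyFlat.exists_path_homotopic {Y : Type*} [TopologicalSpace Y] [T2Space Y]
    [SecondCountableTopology Y] [LocallyCompactSpace Y] {n d : ℕ} [NeZero n] {X : Set Y}
    (hX : IsLocallyFlat n d X) (hnd : d + 2 ≤ n) {x y : (Xᶜ : Set Y)} (γ : Path (x : Y) y) :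
    ∃ γ' : Path x y, (γ'.map continuous_subtype_val).Homotopic γ := by
  -- The constant homotopy of `γ` is kept on three sides and moved off `X` on the fourth. `A ∩ B` is
  -- two corners, mapped to the end points; the new map of the square is itself the homotopy.
  let A : Set (I × I) := {t | t.1 = 0} ∪ ({t | t.2 = 0} ∪ {t | t.2 = 1})
  let B : Set (I × I) := {t | t.1 = 1}
  have hA : IsClosed A := (isClosed_eq continuous_fst continuous_const).union
    ((isClosed_eq continuous_snd continuous_const).union
      (isClosed_eq continuous_snd continuous_const))
  have hB : IsClosed B := isClosed_eq continuous_fst continuous_const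
  let F : C(I × I, Y) := ⟨fun t => γ t.2, γ.continuous.comp continuous_snd⟩
  obtain ⟨G, hGA, hGB⟩ := hX.exists_eqOn_forall_notMem (E' := ℝ) (E := ℝ × ℝ)
    (by rw [Module.finrank_self]; omega) (ℓ := fun s => (1, s)) (by fun_prop) isEmbedding_unitSquare
    hA hB (fun t ht => ⟨t.2, Prod.ext (by simp [show t.1 = 1 from ht]) rfl⟩) F (by
      rintro ⟨s, t⟩ ⟨h | h | h, h'⟩
      · exact absurd (h.symm.trans h') zero_ne_one
      · have : t = 0 := h
        exact fun hm => x.2 (by simpa [F, this] using hm)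
      · have : t = 1 := h
        exact fun hm => y.2 (by simpa [F, this] using hm))
  have h0 : ∀ s, G (s, 0) = x := fun s => (hGA (.inr (.inl rfl))).trans γ.source
  have h1 : ∀ s, G (s, 1) = y := fun s => (hGA (.inr (.inr rfl))).trans γ.target
  let γ' : Path x y :=
    { toFun := fun t => ⟨G (1, t), hGB _ rfl⟩
      continuous_toFun := (G.continuous.comp (by fun_prop)).subtype_mk _
      source' := Subtype.ext (h0 1)
      target' := Subtype.ext (h1 1) }
  refine ⟨γ', Path.Homotopic.symm ⟨{ G with
    map_zero_left := fun t => hGA (.inl rfl)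
    map_one_left := fun t => rfl
    prop' := fun s t ht => ?_ }⟩⟩
  rcases ht with rfl | rfl
  · exact (h0 s).trans γ.source.symm
  · exact (h1 s).trans γ.target.symm

/-- Paths in the complement of a locally flat subset of codimension at least three are homotopic
in the complement if they are homotopic. -/
theorem IsLocallyFlat.homotopic_of_map {Y : Type*} [TopologicalSpace Y] [T2Space Y]
    [SecondCountableTopology Y] [LocallyCompactSpace Y] {n d : ℕ} [NeZero n] {X : Set Y}
    (hX : IsLocallyFlat n d X) (hnd : d + 3 ≤ n) {x y : (Xᶜ : Set Y)} {γ γ' : Path x y}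
    (h : (γ.map continuous_subtype_val).Homotopic (γ'.map continuous_subtype_val)) :
    γ.Homotopic γ' := by
  obtain ⟨F⟩ := h
  let A : Set (I × I) := ({t | t.1 = 0} ∪ {t | t.1 = 1}) ∪ ({t | t.2 = 0} ∪ {t | t.2 = 1})
  have hA : IsClosed A := ((isClosed_eq continuous_fst continuous_const).union
    (isClosed_eq continuous_fst continuous_const)).union
    ((isClosed_eq continuous_snd continuous_const).union
      (isClosed_eq continuous_snd continuous_const))
  obtain ⟨G, hGA, hGB⟩ := hX.exists_eqOn_forall_notMem (E' := ℝ × ℝ) (E := ℝ × ℝ)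
    (by rw [Module.finrank_prod, Module.finrank_self]; omega) (ℓ := id) contDiff_id
    isEmbedding_unitSquare hA isClosed_univ (fun t _ => ⟨_, rfl⟩) (F : C(I × I, Y)) (by
      rintro ⟨s, t⟩ ⟨(h | h) | h | h, -⟩
      · obtain rfl : s = 0 := h
        exact fun hm => (γ t).2 (by simpa using hm)
      · obtain rfl : s = 1 := h
        exact fun hm => (γ' t).2 (by simpa using hm)
      · obtain rfl : t = 0 := h
        exact fun hm => x.2 (by simpa using hm)
      · obtain rfl : t = 1 := h
        exact fun hm => y.2 (by simpa using hm))
  refine ⟨{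
    toFun := fun t => ⟨G t, hGB t (mem_univ _)⟩
    continuous_toFun := G.continuous.subtype_mk _
    map_zero_left := fun t => Subtype.ext ((hGA (.inl (.inl rfl))).trans (F.map_zero_left t))
    map_one_left := fun t => Subtype.ext ((hGA (.inl (.inr rfl))).trans (F.map_one_left t))
    prop' := fun s t ht => Subtype.ext ?_ }⟩
  rcases ht with rfl | rfl
  · exact ((hGA (.inr (.inl rfl))).trans (F.source s)).trans (congrArg _ γ.source.symm)
  · exact ((hGA (.inr (.inr rfl))).trans (F.target s)).trans (congrArg _ γ.target.symm)

/-- Translation along a nonzero normal vector leads from a point of `X` out of the zero set of the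
projection. -/
theorem IsLocallyFlat.exists_joined_compl {Y : Type*} [TopologicalSpace Y] {n d : ℕ} [NeZero n]
    {X : Set Y} (hX : IsLocallyFlat n d X) (hnd : d < n) (y : Y) :
    ∃ x : (Xᶜ : Set Y), Joined (x : Y) y := by
  by_cases hy : y ∈ X
  swap
  · exact ⟨⟨y, hy⟩, .refl y⟩
  obtain ⟨V, hyV, c, hc0, -⟩ := hX.exists_transverseChart hy
  have hz : c.translate y 1 ∉ X := fun h => by
    have h1 := hc0 ⟨_, c.translate_mem y hyV 1⟩ h
    rw [c.proj_translate y hyV, hc0 ⟨y, hyV⟩ hy, zero_add] at h1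
    exact one_ne_zero (congrFun h1 ⟨0, by omega⟩)
  refine ⟨⟨_, hz⟩, Joined.symm ⟨{
    toFun := fun t => c.translate y ((t : ℝ) • (1 : Fin (n - d) → ℝ))
    continuous_toFun := c.continuousOn_translate.comp_continuous
      (f := fun t : I => (y, (t : ℝ) • (1 : Fin (n - d) → ℝ))) (by fun_prop)
      fun t => ⟨hyV, mem_univ _⟩
    source' := by simp [c.translate_zero]
    target' := by simp }⟩⟩

/-- Topological manifolds, possibly with boundary, are Hausdorff second-countable spaces locally
modelled on the closed half-space (whose open subsets include copies of open subsets of `ℝⁿ`). -/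
theorem mainTheorem7 {Y : Type*} [TopologicalSpace Y] [T2Space Y] [SecondCountableTopology Y]
    [ConnectedSpace Y] (n d : ℕ) [NeZero n] [ChartedSpace (EuclideanHalfSpace n) Y]
    (X : Set Y) (hX : IsLocallyFlat n d X) :
    (d + 2 ≤ n →
      Function.Bijective (piZeroMap (complInclusion X)) ∧
      ∀ x : (Xᶜ : Set Y), Function.Surjective (FundamentalGroup.map (complInclusion X) x)) ∧
    (d + 3 ≤ n →
      ∀ x : (Xᶜ : Set Y), Function.Bijective (FundamentalGroup.map (complInclusion X) x)) := by
  have : LocallyCompactSpace (EuclideanHalfSpace n) :=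
    (isClosed_le (f := fun _ : EuclideanSpace ℝ (Fin n) => (0 : ℝ)) (g := fun x => x 0)
      continuous_const (by fun_prop)).isClosedEmbedding_subtypeVal.locallyCompactSpace
  have : LocallyCompactSpace Y := ChartedSpace.locallyCompactSpace (EuclideanHalfSpace n) Y
  have surj : d + 2 ≤ n → ∀ x : (Xᶜ : Set Y),
      Function.Surjective (FundamentalGroup.map (complInclusion X) x) := by
    intro hnd x p
    induction p using Path.Homotopic.Quotient.ind with | mk γ => ?_
    obtain ⟨γ', hγ'⟩ := hX.exists_path_homotopic hnd (x := x) (y := x) γ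
    exact ⟨FundamentalGroup.fromPath (.mk γ'), Quotient.sound hγ'⟩
  refine ⟨fun hnd => ⟨⟨fun a b hab => ?_, fun b => ?_⟩, surj hnd⟩,
    fun hnd x => ⟨fun p q hpq => ?_, surj (by omega) x⟩⟩
  · obtain ⟨a, rfl⟩ := ZerothHomotopy.mk_surjective a
    obtain ⟨b, rfl⟩ := ZerothHomotopy.mk_surjective b
    obtain ⟨γ⟩ : Joined (a : Y) b := Quotient.exact hab
    obtain ⟨γ', -⟩ := hX.exists_path_homotopic hnd γ
    exact ZerothHomotopy.sound γ'
  · obtain ⟨y, rfl⟩ := ZerothHomotopy.mk_surjective b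
    obtain ⟨x, ⟨γ⟩⟩ := hX.exists_joined_compl (by omega) y
    exact ⟨.mk x, ZerothHomotopy.sound γ⟩
  · induction p using Path.Homotopic.Quotient.ind with | mk γ => ?_
    induction q using Path.Homotopic.Quotient.ind with | mk γ' => ?_
    exact Quotient.sound (hX.homotopic_of_map hnd (Quotient.exact hpq))
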